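/- **Setting.** Let $\mathcal X$ be a set, $\mathcal L=\mathcal X\times\{\pm1\}$ and $\mathcal C\subseteq\{\pm1\}^{\mathcal X}$. For $S\subseteq\mathcal L$ let $\mathcal V(S)=\{h\in\mathcal C: h(x)=y\ \forall (x,y)\in S\}$ (the *version spaces*), and for $V\subseteq\mathcal C$ let $V_{x\to y}=\{h\in V:h(x)=y\}$. A set $U\subseteq\mathcal L$ is *realizable* in $V$ if some $h\in V$ is consistent with $U$. A function $f(U;V)$, defined for $U\subseteq\mathcal L$ with $|U|=k$ and version spaces $V$, with values in $[0,c]$, is *$(m,c,k)$-good* for $\mathcal C$ if 1. (monotonicity) $f(U;V)\ge f(U;V_{x\to y})$ whenever $U$ is realizable in $V_{x\to y}$; 2. ($m$-robustness) for every $h\in\mathcal C$ and every $M\subseteq\mathcal L$ with $|M|=m$ that is labeled by $h$, there are $U\subseteq M$ with $|U|=k$ and $(x,y)\in M\setminus U$ such that for every $A\supseteq M\setminus(U\cup\{(x,y)\})$ labeled by $h$, with $V=\mathcal V(A)$, either $f(U;V)-f(U;V_{x\to -y})\ge 1$ or $U$ is not realizable in $V_{x\to -y}$. The *potential* of a finite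 $S\subseteq\mathcal L$ is $\rho_f(S)=\sum_{U\subseteq S,|U|=k}f(U;\mathcal V(S\setminus U))$. The *potential learner* with score $f$ and threshold $\alpha>0$, given the set $S$ of labeled examples seen so far and a new point $x$, predicts $-1$ if $\mathcal V(S)_{x\to+1}=\emptyset$; otherwise it predicts $+1$ if $\mathcal V(S)_{x\to-1}=\emptyset$; otherwise, with $\Delta_b=\rho_f(S)-\rho_f(S\cup\{(x,b)\})$, it predicts $-b^\star$ with $b^\star\in\arg\max_b\Delta_b$ (ties give $b^\star=+1$) if $\max_b\Delta_b\ge\alpha$, and abstains if $\max_b\Delta_b<\alpha$. *Adversarial injection protocol.* A probability distribution $\mathcal D$ on $\mathcal X$ and a target $c^\star\in\mathcal C$ are fixed. In each round $t=1,\dots,T$ an adaptive, possibly randomized adversary, who sees the whole history, either lets nature draw $x_t\sim\mathcal D$ independently of the past, or injects a point $x_t$ of its choice. The learner, who does not see which was the case, observes $x_t$, predicts a label or abstains, and is then shown $c^\star(x_t)$. Let $err_{\mathrm{mis}}$ be the number of rounds with a wrong predicted label, and $err_{\mathrm{abs}}$ the number of rounds drawn by nature on which the learner abstains. The combined error is $\mathbb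 E[err_{\mathrm{mis}}+err_{\mathrm{abs}}]$, the expectation being over nature's draws and the adversary's randomness (read as a lower integral where the error is not measurable). A partial order $\preceq$ on $\mathcal X$ is a *tree order* if each $I(x)=\{x':x'\preceq x\}$ is totally ordered. An *initial segment* is a downward closed, totally ordered subset (possibly empty). For $r,h:\mathcal X\to\{\pm1\}$ let $h_r(x)=-h(x)r(x)$. For a set $V$ of concepts let $P(V)=\{x: V_{x\to-1}=\emptyset\}$ and $f_{\mathrm{seg}}(\{(x,y)\};V)=\mathbf 1[P(V)\subseteq I(x)]$. **Statement.** There are a constant $K$, an exponent $p\in\mathbb N$ and thresholds $\alpha_T>0$ ($T\in\mathbb N$), independent of $\mathcal X$, $\mathcal C$, $\mathcal D$, $c^\star$ and the adversary, such that the following hold. (a) Let $\preceq$ be a tree order on $\mathcal X$ and let $\mathcal C$ be a class such that $h^{-1}(+1)$ is an initial segment for all $h\in\mathcal C$ (for instance, the class of all initial segments). Then $f_{\mathrm{seg}}$ is $(3,1,1)$-good for $\mathcal C$, and for every $T\ge1$ the potential learner with score $f_{\mathrm{seg}}$ and threshold $\alpha_T$ has combined error at most $K\sqrt T(1+\log T)^p$,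 for every $\mathcal D$, every $c^\star\in\mathcal C$ and every adversary. (b) For every class $\mathcal C\subseteq\{\pm1\}^{\mathcal X}$: $\mathrm{VCdim}(\mathcal C)\le1$ if and only if for every $r\in\mathcal C$ there is a tree order on $\mathcal X$ such that $h_r^{-1}(+1)$ is an initial segment for all $h\in\mathcal C$. (c) For every class $\mathcal C\subseteq\{\pm1\}^{\mathcal X}$ with $\mathrm{VCdim}(\mathcal C)\le1$ there is a $(3,1,1)$-good function $f$ for $\mathcal C$ such that for every $T\ge1$ the potential learner with score $f$ and threshold $\alpha_T$ has combined error at most $K\sqrt T(1+\log T)^p$, for every $\mathcal D$, every $c^\star\in\mathcal C$ and every adversary. That is, its combined error is $\tilde O(\sqrt T)$. -/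

import Mathlib

open MeasureTheory

universe u v

/-- The label set `{+1, -1}`. -/
abbrev Label : Type := ℤˣ

/-- Labeled examples over the domain `X`. -/
abbrev Labeled (X : Type u) : Type u := X × Label

section Concepts

variable {X : Type u}

/-- `h` labels every example of `S` correctly. -/
def Consistent (h : X → Label) (S : Set (Labeled X)) : Prop :=
  ∀ z ∈ S, h z.1 = z.2

/-- The concepts of `C` that are consistent with `S`. -/
def versionSpace (C : Set (X → Label)) (S : Set (Labeled X)) : Set (X → Label) :=
  {h | h ∈ C ∧ Consistent h S}

/-- The family of all version spaces of `C`. -/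
def versionSpaces (C : Set (X → Label)) : Set (Set (X → Label)) :=
  {V | ∃ S : Set (Labeled X), V = versionSpace C S}

/-- The restriction of `V` to the concepts that label `x` by `y`. -/
def restrict (V : Set (X → Label)) (x : X) (y : Label) : Set (X → Label) :=
  {h | h ∈ V ∧ h x = y}

/-- The labeled set `U` is realizable in `V`. -/
def RealizableIn (U : Set (Labeled X)) (V : Set (X → Label)) : Prop :=
  ∃ h ∈ V, Consistent h U

/-- `C` shatters the finite set `S`: every labeling of `S` is induced by a concept of `C`. -/
def ClassShatters (C : Set (X → Label)) (S : Finset X) : Prop :=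
  ∀ l : X → Label, ∃ h ∈ C, ∀ x ∈ S, h x = l x

/-- The VC dimension of `C` is at most `d`. -/
def VCDimLE (C : Set (X → Label)) (d : ℕ) : Prop :=
  ∀ S : Finset X, ClassShatters C S → S.card ≤ d

/-- The relabeling of `h` by the reference `r`: `+1` where `h` and `r` differ and `-1` where
they agree. -/
def relabel (r h : X → Label) : X → Label :=
  fun x => -(h x * r x)

end Concepts

section ScoreFunctions

variable {X : Type u}

/-- The score function `f`, evaluated at `k`-element labeled sets and version spaces of `C`, is
`(m, c, k)`-good for `C`. Only the values of `f` on this domain matter. -/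
structure IsGood (C : Set (X → Label)) (m : ℕ) (c : ℝ) (k : ℕ)
    (f : Finset (Labeled X) → Set (X → Label) → ℝ) : Prop where
  /-- `f` takes values in `[0, c]`. -/
  bounded : ∀ U : Finset (Labeled X), U.card = k → ∀ V ∈ versionSpaces C,
    f U V ∈ Set.Icc 0 c
  /-- Monotonicity: restricting by an example which is realizable together with `U` in `V` does
  not increase the score of `U`. -/
  monotone : ∀ U : Finset (Labeled X), U.card = k → ∀ V ∈ versionSpaces C,
    ∀ (x : X) (y : Label), RealizableIn (U : Set (Labeled X)) (restrict V x y) →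
      f U (restrict V x y) ≤ f U V
  /-- Robustness with window `m`. -/
  robust : ∀ h ∈ C, ∀ M : Finset (Labeled X), M.card = m →
    Consistent h (M : Set (Labeled X)) →
    ∃ U : Finset (Labeled X), U ⊆ M ∧ U.card = k ∧ ∃ z ∈ M, z ∉ U ∧
      ∀ A : Set (Labeled X), (∀ a ∈ M, a ∉ U → a ≠ z → a ∈ A) → Consistent h A →
        1 ≤ f U (versionSpace C A) - f U (restrict (versionSpace C A) z.1 (-z.2)) ∨
          ¬ RealizableIn (U : Set (Labeled X)) (restrict (versionSpace C A) z.1 (-z.2))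

open Classical in
/-- The leave-`k`-out potential of the finite labeled set `S`. -/
noncomputable def potential (C : Set (X → Label)) (k : ℕ)
    (f : Finset (Labeled X) → Set (X → Label) → ℝ) (S : Finset (Labeled X)) : ℝ :=
  ∑ U ∈ S.powersetCard k, f U (versionSpace C ((S \ U : Finset (Labeled X)) : Set (Labeled X)))

open Classical in
/-- The drop of the potential when `(x, b)` is added to `S`. -/
noncomputable def potentialDrop (C : Set (X → Label)) (k : ℕ)
    (f : Finset (Labeled X) → Set (X → Label) → ℝ) (S : Finset (Labeled X))
    (x : X) (b : Label) : ℝ :=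
  potential C k f S - potential C k f (insert (x, b) S)

open Classical in
/-- One step of the potential learner with score function `f` and threshold `α`: its output on the
point `x` when `S` is the set of labeled examples seen so far. The value `none` is abstention. If
both potential drops are equal and at least `α`, the maximizing label is taken to be `+1`. -/
noncomputable def potentialLearner (C : Set (X → Label)) (k : ℕ)
    (f : Finset (Labeled X) → Set (X → Label) → ℝ) (α : ℝ)
    (S : Finset (Labeled X)) (x : X) : Option Label :=
  if restrict (versionSpace C (S : Set (Labeled X))) x 1 = ∅ then some (-1)
  else if restrict (versionSpace C (S : Set (Labeled X))) x (-1) = ∅ then some 1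
  else if α ≤ max (potentialDrop C k f S x 1) (potentialDrop C k f S x (-1)) then
    if potentialDrop C k f S x (-1) ≤ potentialDrop C k f S x 1 then some (-1) else some 1
  else none

end ScoreFunctions

section Injection

variable {X : Type u}

/-- The record of one round: whether the point was injected by the adversary, the point, the
output of the learner (`none` for abstention), and the true label. -/
structure Round (X : Type u) where
  injected : Bool
  point : X
  output : Option Label
  label : Label

open Classical in
/-- The set of labeled examples of a history. -/
noncomputable def seenExamples (hist : List (Round X)) : Finset (Labeled X) :=
  (hist.map fun ρ => (ρ.point, ρ.label)).toFinset

/-- The number of rounds of a history whose point was drawn by nature. -/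
def naturalRounds (hist : List (Round X)) : ℕ :=
  hist.countP fun ρ => !ρ.injected

/-- The next round after the history `hist`. The adversary either injects a point (`some x`) or
lets nature draw (`none`); the `i`-th draw of nature, counting from `0`, is `ω i`. -/
noncomputable def nextRound (learner : Finset (Labeled X) → X → Option Label) (target : X → Label)
    (adversary : List (Round X) → Option X) (ω : ℕ → X) (hist : List (Round X)) : Round X :=
  let x : X := (adversary hist).getD (ω (naturalRounds hist))
  { injected := (adversary hist).isSome
    point := x
    output := learner (seenExamples hist) x
    label := target x }

/-- The history of the first `T` rounds of the adversarial injection protocol. -/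
noncomputable def play (learner : Finset (Labeled X) → X → Option Label) (target : X → Label)
    (adversary : List (Round X) → Option X) (ω : ℕ → X) : ℕ → List (Round X)
  | 0 => []
  | T + 1 => play learner target adversary ω T ++
      [nextRound learner target adversary ω (play learner target adversary ω T)]

/-- The number of rounds in which the learner predicted a wrong label. -/
def misErrors (hist : List (Round X)) : ℕ :=
  hist.countP fun ρ => decide (ρ.output ≠ some ρ.label ∧ ρ.output ≠ none)

/-- The number of rounds drawn by nature in which the learner abstained. -/
def absErrors (hist : List (Round X)) : ℕ :=
  hist.countP fun ρ => decide (ρ.output = none ∧ ρ.injected = false)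

/-- The expected combined error after `T` rounds, over the independent draws of nature from `D`
and the private random seed of the adversary, which has law `ν`. The integral is a Lebesgue
integral in `[0, ∞]`: it is the expectation whenever the error is a measurable function of the
randomness, and no measurability is imposed on the adversary, the target or the learner (for a
non-measurable error it is the supremum of the integrals of the measurable functions below it). -/
noncomputable def expectedCombinedError [MeasurableSpace X]
    (learner : Finset (Labeled X) → X → Option Label) (target : X → Label)
    (D : Measure X) [IsProbabilityMeasure D]
    {R : Type v} [MeasurableSpace R] (ν : Measure R)
    (adversary : R → List (Round X) → Option X) (T : ℕ) : ENNReal :=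
  ∫⁻ s : R × (ℕ → X),
    ((misErrors (play learner target (adversary s.1) s.2 T)
      + absErrors (play learner target (adversary s.1) s.2 T) : ℕ) : ENNReal)
    ∂(ν.prod (Measure.infinitePi fun _ : ℕ => D))

/-- For every horizon `T ≥ 1`, the potential learner for `C` with score function `f` and threshold
`α T` has expected combined error at most `B T`, against every distribution, every target in `C`
and every adaptive, possibly randomized, adversary. -/
def AchievesCombinedError (C : Set (X → Label)) (k : ℕ)
    (f : Finset (Labeled X) → Set (X → Label) → ℝ) (α B : ℕ → ℝ) : Prop :=
  ∀ T : ℕ, 1 ≤ T →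
    ∀ (_ : MeasurableSpace X) (D : Measure X) (_ : IsProbabilityMeasure D), ∀ target ∈ C,
    ∀ (R : Type v) (_ : MeasurableSpace R) (ν : Measure R) (_ : IsProbabilityMeasure ν)
      (adversary : R → List (Round X) → Option X),
      expectedCombinedError (potentialLearner C k f (α T)) target D ν adversary T
        ≤ ENNReal.ofReal (B T)

end Injection

section TreeOrders

/-- A tree order: the points below any given point are pairwise comparable. -/
def IsTreeOrder (X : Type u) [PartialOrder X] : Prop :=
  ∀ x : X, IsChain (· ≤ ·) (Set.Iic x)

variable {X : Type u}

/-- Initial segments: downward closed sets of pairwise comparable points. In a tree order these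
are the sets `Set.Iic x`, the empty set, and the unions of chains of sets `Set.Iic x`. -/
def IsInitialSegment [PartialOrder X] (I : Set X) : Prop :=
  IsLowerSet I ∧ IsChain (· ≤ ·) I

/-- The points that are forced to be labeled `+1` under `V`. -/
def forcedPositive (V : Set (X → Label)) : Set X :=
  {x | restrict V x (-1) = ∅}

open Classical in
/-- The score function for initial segments. At a singleton `{(x, y)}` it is the indicator of
`forcedPositive V ⊆ Set.Iic x`. -/
noncomputable def segScore [PartialOrder X]
    (U : Finset (Labeled X)) (V : Set (X → Label)) : ℝ :=
  if ∀ z ∈ U, forcedPositive V ⊆ Set.Iic z.1 then 1 else 0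

end TreeOrders

/-! ### Potential accounting: mistakes and attackable draws -/

section Learning

variable {X : Type u} {C : Set (X → Label)} {f : Finset (Labeled X) → Set (X → Label) → ℝ}

/-! Any `(3, 1, 1)`-good score gives the error bound, so the rest is to produce such scores.

Mistakes: the leave-one-out potential starts at 0, is never negative, and rises by at most 1 per
round, because monotonicity lets no old score increase and the new example scores at most 1. A
mistake lowers it by at least `α`, so there are at most `T / α` mistakes, whatever the adversary
does (`IsGood.mul_misErrors_add_potential_le`).

Abstentions: call a natural draw attackable if some correctly labeled set containing all earlier
draws makes the learner abstain on it. This no longer mentions the adversary. An abstention bounds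
the potential drop for the wrong label by `α`, so each attacked example can lower only about `α`
other scores by 1; robustness finds such a pair in every triple. Double counting leaves at most `6 *
α + 9` attackable examples among `n + 1` (`IsGood.card_attackable_le`). By exchangeability draw `n`
contributes at most `(6 * α + 9) / (n + 1)`, and the harmonic sum gives a bound of order `α log T`.
The choice `α = √T` balances both terms.

Goodness: among three examples, two are both inside or both outside the target segment. Either one
fixes the label of the other, or making one positive forces a point not below the other and destroys
its score (`signedSegScore_robust_pair`). For VC dimension at most one, the sets where concepts
differ from a fixed `r ∈ C` are segments of the order by reverse inclusion of membership; a failure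
of comparability inside one set would shatter a pair. The score is then signed by `-r`, leaving the
class and the learner unchanged. -/

theorem Label.eq_neg_of_ne {a b : Label} (h : a ≠ b) : a = -b := by
  rcases Int.units_eq_one_or a with rfl | rfl <;> rcases Int.units_eq_one_or b with rfl | rfl <;>
    simp_all

theorem Label.ne_neg_self (a : Label) : a ≠ -a := by
  rcases Int.units_eq_one_or a with rfl | rfl <;> decide

theorem versionSpace_insert (S : Set (Labeled X)) (x : X) (y : Label) :
    versionSpace C (insert (x, y) S) = restrict (versionSpace C S) x y := by
  ext h
  simp only [versionSpace, restrict, Consistent, Set.mem_ofPred_eq, Set.mem_insert_iff,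
    forall_eq_or_imp]
  tauto

theorem versionSpace_mem (S : Set (Labeled X)) : versionSpace C S ∈ versionSpaces C := ⟨S, rfl⟩

open Classical in
theorem potential_one (S : Finset (Labeled X)) :
    potential C 1 f S = ∑ u ∈ S, f {u} (versionSpace C ((S.erase u : Finset _) : Set _)) := by
  rw [potential, Finset.powersetCard_one, Finset.sum_map]
  refine Finset.sum_congr rfl fun u _ => ?_
  simp [Finset.sdiff_singleton_eq_erase]

open Classical in
/-- The drop of the leave-one-out potential is the sum of the drops of the scores, minus the score
of the new example. -/
theorem potentialDrop_one {S : Finset (Labeled X)} {x : X} {b : Label} (hx : (x, b) ∉ S) :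
    potentialDrop C 1 f S x b =
      ∑ u ∈ S, (f {u} (versionSpace C ((S.erase u : Finset _) : Set _)) -
        f {u} (restrict (versionSpace C ((S.erase u : Finset _) : Set _)) x b)) -
      f {(x, b)} (versionSpace C (S : Set _)) := by
  rw [potentialDrop, potential_one, potential_one, Finset.sum_insert hx,
    Finset.erase_insert hx, Finset.sum_sub_distrib]
  have : ∀ u ∈ S, f {u} (versionSpace C (((insert (x, b) S).erase u : Finset _) : Set _)) =
      f {u} (restrict (versionSpace C ((S.erase u : Finset _) : Set _)) x b) := by
    intro u hu
    -- Leaving out an old example commutes with adding the new one, so the version space is just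
    -- restricted.
    rw [Finset.erase_insert_of_ne (by rintro rfl; exact hx hu), Finset.coe_insert,
      versionSpace_insert]
  rw [Finset.sum_congr rfl this]
  ring

open Classical in
theorem realizableIn_restrict_erase {S : Finset (Labeled X)} {x : X} {b : Label}
    (hne : (restrict (versionSpace C (S : Set (Labeled X))) x b).Nonempty) {u : Labeled X}
    (hu : u ∈ S) :
    RealizableIn ((({u} : Finset (Labeled X))) : Set (Labeled X))
      (restrict (versionSpace C ((S.erase u : Finset _) : Set _)) x b) := by
  obtain ⟨g, ⟨hgC, hgS⟩, hgx⟩ := hne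
  refine ⟨g, ⟨⟨hgC, fun z hz => hgS z ?_⟩, hgx⟩, fun z hz => ?_⟩
  · exact Finset.mem_of_mem_erase (Finset.mem_coe.1 hz)
  · simp only [Finset.coe_singleton, Set.mem_singleton_iff] at hz
    subst hz
    exact hgS _ hu

open Classical in
theorem IsGood.score_drop_nonneg {m : ℕ} (hf : IsGood C m 1 1 f) {S : Finset (Labeled X)} {x : X}
    {b : Label} (hne : (restrict (versionSpace C (S : Set (Labeled X))) x b).Nonempty)
    {u : Labeled X} (hu : u ∈ S) :
    0 ≤ f {u} (versionSpace C ((S.erase u : Finset _) : Set _)) -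
      f {u} (restrict (versionSpace C ((S.erase u : Finset _) : Set _)) x b) :=
  sub_nonneg.2 <| hf.monotone {u} (Finset.card_singleton u) _ (versionSpace_mem _) x b
    (realizableIn_restrict_erase hne hu)

theorem IsGood.neg_one_le_potentialDrop {m : ℕ} (hf : IsGood C m 1 1 f) {S : Finset (Labeled X)}
    {x : X} {b : Label} (hne : (restrict (versionSpace C (S : Set (Labeled X))) x b).Nonempty) :
    -1 ≤ potentialDrop C 1 f S x b := by
  classical
  by_cases hx : (x, b) ∈ S
  · simp [potentialDrop, Finset.insert_eq_of_mem hx]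
  · rw [potentialDrop_one hx]
    have h1 := Finset.sum_nonneg fun u (hu : u ∈ S) => hf.score_drop_nonneg hne hu
    have h2 := (hf.bounded {(x, b)} (Finset.card_singleton _) _
      (versionSpace_mem (S : Set (Labeled X)))).2
    linarith

theorem IsGood.potential_nonneg {m : ℕ} (hf : IsGood C m 1 1 f) (S : Finset (Labeled X)) :
    0 ≤ potential C 1 f S := by
  classical
  rw [potential_one]
  exact Finset.sum_nonneg fun u _ =>
    (hf.bounded {u} (Finset.card_singleton _) _ (versionSpace_mem _)).1

/-- A wrong prediction costs at least `α` of potential. -/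
theorem le_potentialDrop_of_mistake {k : ℕ} {α : ℝ} {S : Finset (Labeled X)} {x : X} {y : Label}
    (hne : (restrict (versionSpace C (S : Set (Labeled X))) x y).Nonempty)
    (h1 : potentialLearner C k f α S x ≠ some y) (h2 : potentialLearner C k f α S x ≠ none) :
    α ≤ potentialDrop C k f S x y := by
  unfold potentialLearner at h1 h2
  have key := Int.units_eq_one_or y
  split_ifs at h1 h2 with c1 c2 c3 c4
  · rcases key with rfl | rfl
    · exact absurd c1 hne.ne_empty
    · exact absurd rfl h1
  · rcases key with rfl | rfl
    · exact absurd rfl h1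
    · exact absurd c2 hne.ne_empty
  · rcases key with rfl | rfl
    · rwa [max_eq_left c4] at c3
    · exact absurd rfl h1
  · rcases key with rfl | rfl
    · exact absurd rfl h1
    · rwa [max_eq_right (not_le.1 c4).le] at c3
  · exact absurd rfl h2

/-- When the learner abstains, neither label is forced and both potential drops are below the
threshold. -/
theorem of_potentialLearner_eq_none {k : ℕ} {α : ℝ} {S : Finset (Labeled X)} {x : X}
    (h : potentialLearner C k f α S x = none) (y : Label) :
    (restrict (versionSpace C (S : Set (Labeled X))) x y).Nonempty ∧
      potentialDrop C k f S x y < α := by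
  unfold potentialLearner at h
  split_ifs at h with c1 c2 c3
  have h3 := max_lt_iff.1 (not_le.1 c3)
  rcases Int.units_eq_one_or y with rfl | rfl
  · exact ⟨Set.nonempty_iff_ne_empty.2 c1, h3.1⟩
  · exact ⟨Set.nonempty_iff_ne_empty.2 c2, h3.2⟩

/-- The learner does not abstain on a point it has already seen. -/
theorem not_mem_of_potentialLearner_eq_none {k : ℕ} {α : ℝ} {S : Finset (Labeled X)}
    {z : Labeled X} (h : potentialLearner C k f α S z.1 = none) : z ∉ S := by
  intro hz
  obtain ⟨g, ⟨-, hgS⟩, hgx⟩ := (of_potentialLearner_eq_none h (-z.2)).1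
  exact Label.ne_neg_self z.2 ((hgS z hz).symm.trans hgx)

theorem seenExamples_append_singleton [DecidableEq (Labeled X)] (hist : List (Round X))
    (ρ : Round X) :
    seenExamples (hist ++ [ρ]) = insert (ρ.point, ρ.label) (seenExamples hist) := by
  ext z
  simp [seenExamples]

theorem consistent_seenExamples (learner : Finset (Labeled X) → X → Option Label)
    (target : X → Label) (adversary : List (Round X) → Option X) (ω : ℕ → X) (T : ℕ) :
    Consistent target (seenExamples (play learner target adversary ω T) : Set (Labeled X)) := by
  classical
  induction T with
  | zero => simp [Consistent, play, seenExamples]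
  | succ T ih =>
    rw [play, seenExamples_append_singleton, Finset.coe_insert]
    rintro z (rfl | hz)
    · rfl
    · exact ih z hz

/-- Every mistake is paid for by the potential, which grows by at most one per round. -/
theorem IsGood.mul_misErrors_add_potential_le {m : ℕ} (hf : IsGood C m 1 1 f) {α : ℝ}
    {target : X → Label} (ht : target ∈ C) (adversary : List (Round X) → Option X)
    (ω : ℕ → X) (T : ℕ) :
    α * misErrors (play (potentialLearner C 1 f α) target adversary ω T) +
      potential C 1 f
        (seenExamples (play (potentialLearner C 1 f α) target adversary ω T)) ≤ T := by
  classical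
  induction T with
  | zero => simp [play, misErrors, seenExamples, potential_one]
  | succ T ih =>
    have hcons := consistent_seenExamples (potentialLearner C 1 f α) target adversary ω T
    rw [play, seenExamples_append_singleton]
    set H := play (potentialLearner C 1 f α) target adversary ω T
    set ρ := nextRound (potentialLearner C 1 f α) target adversary ω H with hρ
    have hlabel : ρ.label = target ρ.point := rfl
    have hout : ρ.output = potentialLearner C 1 f α (seenExamples H) ρ.point := rfl
    have hne : (restrict (versionSpace C (seenExamples H : Set (Labeled X)))
        ρ.point ρ.label).Nonempty := ⟨target, ⟨ht, hcons⟩, rfl⟩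
    have hdrop : potential C 1 f (insert (ρ.point, ρ.label) (seenExamples H)) =
        potential C 1 f (seenExamples H) -
          potentialDrop C 1 f (seenExamples H) ρ.point ρ.label := by
      rw [potentialDrop]
      convert (sub_sub_cancel _ _).symm
    rw [hdrop]
    push_cast
    have hge := hf.neg_one_le_potentialDrop hne
    by_cases hm : ρ.output ≠ some ρ.label ∧ ρ.output ≠ none
    · have h1 : misErrors (H ++ [ρ]) = misErrors H + 1 := by
        simp [misErrors, List.countP_append, hm]
      have h2 := le_potentialDrop_of_mistake hne (hout ▸ hm.1) (hout ▸ hm.2)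
      rw [h1]
      push_cast
      linarith
    · have h1 : misErrors (H ++ [ρ]) = misErrors H := by
        simp only [misErrors, List.countP_append, List.countP_singleton]
        simp [hm]
      rw [h1]
      linarith

/-- `Attackable learner target ω n`: some set of correctly labeled examples that contains the
first `n` draws makes the learner abstain on the next draw. -/
def Attackable (learner : Finset (Labeled X) → X → Option Label) (target : X → Label)
    (ω : ℕ → X) (n : ℕ) : Prop :=
  ∃ S : Finset (Labeled X), (∀ i < n, (ω i, target (ω i)) ∈ S) ∧
    Consistent target (S : Set (Labeled X)) ∧ learner S (ω n) = none

theorem naturalRounds_play_le (learner : Finset (Labeled X) → X → Option Label)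
    (target : X → Label) (adversary : List (Round X) → Option X) (ω : ℕ → X) (T : ℕ) :
    naturalRounds (play learner target adversary ω T) ≤ T := by
  induction T with
  | zero => simp [play, naturalRounds]
  | succ T ih =>
    rw [play, naturalRounds, List.countP_append]
    exact add_le_add ih (List.countP_le_length.trans (by simp))

theorem mem_seenExamples_of_lt_naturalRounds (learner : Finset (Labeled X) → X → Option Label)
    (target : X → Label) (adversary : List (Round X) → Option X) (ω : ℕ → X) (T : ℕ) :
    ∀ i < naturalRounds (play learner target adversary ω T),
      (ω i, target (ω i)) ∈ seenExamples (play learner target adversary ω T) := by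
  classical
  induction T with
  | zero => simp [play, naturalRounds]
  | succ T ih =>
    intro i hi
    rw [play, seenExamples_append_singleton]
    rw [play, naturalRounds, List.countP_append] at hi
    set H := play learner target adversary ω T
    rcases lt_or_ge i (naturalRounds H) with h | h
    · exact Finset.mem_insert_of_mem (ih i h)
    · unfold naturalRounds at h
      cases hadv : adversary H with
      | some x => simp [nextRound, hadv] at hi; omega
      | none =>
        have : i = naturalRounds H := by
          simp [nextRound, hadv] at hi
          unfold naturalRounds
          omega
        subst this
        simp [nextRound, hadv]

-- The actual history at a natural draw witnesses attackability, whatever was injected before it.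
-- The adaptive game is thereby bounded by a function of the draws alone, apart from the number of
-- natural rounds.
open Classical in
theorem absErrors_play_le (learner : Finset (Labeled X) → X → Option Label)
    (target : X → Label) (adversary : List (Round X) → Option X) (ω : ℕ → X) (T : ℕ) :
    absErrors (play learner target adversary ω T) ≤
      ∑ n ∈ Finset.range (naturalRounds (play learner target adversary ω T)),
        if Attackable learner target ω n then 1 else 0 := by
  induction T with
  | zero => simp [play, absErrors]
  | succ T ih =>
    have hcons := consistent_seenExamples learner target adversary ω T
    have hmem := mem_seenExamples_of_lt_naturalRounds learner target adversary ω T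
    rw [play]
    set H := play learner target adversary ω T
    cases hadv : adversary H with
    | some x =>
      have h1 : naturalRounds (H ++ [nextRound learner target adversary ω H]) =
          naturalRounds H := by
        simp [naturalRounds, nextRound, hadv]
      have h2 : absErrors (H ++ [nextRound learner target adversary ω H]) = absErrors H := by
        simp [absErrors, nextRound, hadv]
      rwa [h1, h2]
    | none =>
      have h1 : naturalRounds (H ++ [nextRound learner target adversary ω H]) =
          naturalRounds H + 1 := by
        simp [naturalRounds, nextRound, hadv]
      rw [h1, Finset.sum_range_succ, absErrors, List.countP_append]
      refine add_le_add ih ?_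
      split_ifs with hatt
      · exact List.countP_le_length.trans (by simp)
      · have : learner (seenExamples H) (ω (naturalRounds H)) ≠ none := fun h =>
          hatt ⟨seenExamples H, hmem, hcons, h⟩
        simp [nextRound, hadv, this]

end Learning

/-! ### Double counting of attackable examples -/

section Counting

variable {X : Type u} {C : Set (X → Label)} {f : Finset (Labeled X) → Set (X → Label) → ℝ}

/-- If every three-element subset of `B` contains a pair related by `R`, where each point of `B` is
related to at most `d` others, then `B` has at most `6 d + 3` elements. -/
theorem card_le_of_forall_triple {β : Type*} [DecidableEq β] (B : Finset β) (R : β → β → Prop)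
    [DecidableRel R] {d : ℝ} (hd : 0 ≤ d)
    (htriple : ∀ M ⊆ B, M.card = 3 → ∃ z ∈ M, ∃ u ∈ M, u ≠ z ∧ R z u)
    (hdeg : ∀ z ∈ B, ((B.filter fun u => R z u).card : ℝ) ≤ d) :
    (B.card : ℝ) ≤ 6 * d + 3 := by
  set P : Finset (β × β) := (B ×ˢ B).filter fun p => R p.1 p.2 with hP
  have hPcard : (P.card : ℝ) ≤ B.card * d := by
    have h1 : P.card = ∑ z ∈ B, (B.filter fun u => R z u).card := by
      rw [hP, Finset.card_filter, Finset.sum_product]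
      exact Finset.sum_congr rfl fun z _ => (Finset.card_filter _ _).symm
    rw [h1]
    push_cast
    calc _ ≤ ∑ _z ∈ B, d := Finset.sum_le_sum hdeg
      _ = B.card * d := by simp
  -- Each triple consists of a related pair and a third point, so there are at most `|P| * |B| ≤ d *
  -- |B| ^ 2` triples.
  have hsub : B.powersetCard 3 ⊆
      (P ×ˢ B).image fun q => ({q.1.1, q.1.2, q.2} : Finset β) := by
    intro M hM
    obtain ⟨hMB, hM3⟩ := Finset.mem_powersetCard.1 hM
    obtain ⟨z, hz, u, hu, hne, hR⟩ := htriple M hMB hM3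
    have hc : ((M.erase z).erase u).card = 1 := by
      rw [Finset.card_erase_of_mem (Finset.mem_erase.2 ⟨hne, hu⟩), Finset.card_erase_of_mem hz,
        hM3]
    obtain ⟨w, hw⟩ := Finset.card_eq_one.1 hc
    have hwM : w ∈ M := by
      have : w ∈ (M.erase z).erase u := by simp [hw]
      exact Finset.mem_of_mem_erase (Finset.mem_of_mem_erase this)
    refine Finset.mem_image.2 ⟨((z, u), w), ?_, ?_⟩
    · simp [hP, hMB hz, hMB hu, hMB hwM, hR]
    · have h1 := Finset.insert_erase (Finset.mem_erase.2 ⟨hne, hu⟩)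
      rw [hw] at h1
      have h2 := Finset.insert_erase hz
      rw [← h1] at h2
      exact h2
  have hchoose : (B.card.choose 3 : ℝ) ≤ P.card * B.card := by
    have := (Finset.card_le_card hsub).trans Finset.card_image_le
    rw [Finset.card_powersetCard, Finset.card_product] at this
    exact_mod_cast this
  have hdesc := Nat.descFactorial_eq_factorial_mul_choose B.card 3
  by_contra! hlt
  obtain ⟨k, hk⟩ : ∃ k, B.card = k + 3 := by
    refine ⟨B.card - 3, (Nat.sub_add_cancel ?_).symm⟩
    have : (3 : ℝ) ≤ B.card := by linarith
    exact_mod_cast this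
  rw [hk] at hlt hPcard hchoose hdesc
  simp only [Nat.descFactorial_succ, Nat.descFactorial_zero, Nat.factorial] at hdesc
  have hdesc' : ((k : ℝ) + 1) * ((k + 2) * (k + 3)) = 6 * ((k + 3).choose 3 : ℕ) := by
    have e1 : k + 3 - 2 = k + 1 := by omega
    have e2 : k + 3 - 1 = k + 2 := by omega
    rw [e1, e2] at hdesc
    have := congrArg (Nat.cast (R := ℝ)) hdesc
    push_cast at this
    linarith
  push_cast at hlt hPcard hchoose
  have hk0 : (0 : ℝ) ≤ k := Nat.cast_nonneg k
  have h3 : ((k : ℝ) + 1) * ((k + 2) * (k + 3)) ≤ 6 * ((k + 3) * d * (k + 3)) := by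
    rw [hdesc']
    have := mul_le_mul_of_nonneg_right hPcard (by linarith : (0 : ℝ) ≤ k + 3)
    linarith
  have h4 : ((k : ℝ) + 1) * (k + 2) ≤ 6 * d * (k + 3) := by
    have : (((k : ℝ) + 1) * (k + 2)) * (k + 3) ≤ (6 * d * (k + 3)) * (k + 3) := by linarith
    exact le_of_mul_le_mul_right this (by linarith)
  -- With `6 * d < k` this would give `(k + 1) * (k + 2) ≤ k * (k + 3)`, which is off by 2.
  nlinarith [mul_le_mul_of_nonneg_right (show 6 * d ≤ k by linarith) (show (0 : ℝ) ≤ k + 3 by linarith)]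

/-- Only few examples can be attacked simultaneously when the score is `(3, 1, 1)`-good. -/
theorem IsGood.card_attackable_le (hf : IsGood C 3 1 1 f) {α : ℝ} (hα : 0 ≤ α)
    {target : X → Label} (ht : target ∈ C) (B : Finset (Labeled X))
    (hB : Consistent target (B : Set (Labeled X)))
    (hatt : ∀ z ∈ B, ∃ S : Finset (Labeled X), (∀ w ∈ B, w ≠ z → w ∈ S) ∧
      Consistent target (S : Set (Labeled X)) ∧ potentialLearner C 1 f α S z.1 = none) :
    (B.card : ℝ) ≤ 6 * α + 9 := by
  classical
  choose! S hBS hS hnone using hatt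
  -- The loss of score of `u` when `z` gets the wrong label, measured in the set `S z` that attacks
  -- `z`.
  let drop : Labeled X → Labeled X → ℝ := fun z u =>
    f {u} (versionSpace C (((S z).erase u : Finset _) : Set _)) -
      f {u} (restrict (versionSpace C (((S z).erase u : Finset _) : Set _)) z.1 (-z.2))
  have key := card_le_of_forall_triple B (fun z u => u ≠ z ∧ 1 ≤ drop z u) (d := α + 1)
    (by linarith) ?_ ?_
  · linarith
  · intro M hMB hM3
    obtain ⟨U, hUM, hU1, z, hz, hzU, hrob⟩ := hf.robust target ht M hM3
      (fun z hz => hB z (hMB hz))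
    obtain ⟨u, rfl⟩ := Finset.card_eq_one.1 hU1
    have hu : u ∈ M := hUM (Finset.mem_singleton_self u)
    have hne : u ≠ z := fun h => hzU (by simp [h])
    refine ⟨z, hz, u, hu, hne, hne, ?_⟩
    have huS : u ∈ S z := hBS z (hMB hz) u (hMB hu) hne
    refine (hrob (((S z).erase u : Finset _) : Set _) ?_ ?_).resolve_right ?_
    · intro a haM haU haz
      exact Finset.mem_coe.2 (Finset.mem_erase.2
        ⟨fun h => haU (by simp [h]), hBS z (hMB hz) a (hMB haM) haz⟩)
    · exact fun a ha => hS z (hMB hz) a (Finset.mem_of_mem_erase (Finset.mem_coe.1 ha))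
    · exact not_not.2 (realizableIn_restrict_erase
        (of_potentialLearner_eq_none (hnone z (hMB hz)) (-z.2)).1 huS)
  · intro z hz
    obtain ⟨hne, hlt⟩ := of_potentialLearner_eq_none (hnone z hz) (-z.2)
    have hnot : (z.1, -z.2) ∉ S z := fun h =>
      Label.ne_neg_self z.2 ((hB z hz).symm.trans (hS z hz _ h))
    rw [potentialDrop_one hnot] at hlt
    -- The score of the flipped example itself offsets at most 1 of the drop; hence the degree bound
    -- `α + 1` rather than `α`.
    have hle := (hf.bounded {(z.1, -z.2)} (Finset.card_singleton _) _
      (versionSpace_mem (S z : Set (Labeled X)))).2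
    have hsum : ((B.filter fun u => u ≠ z ∧ 1 ≤ drop z u).card : ℝ) ≤ ∑ u ∈ S z, drop z u := by
      calc ((B.filter fun u => u ≠ z ∧ 1 ≤ drop z u).card : ℝ)
          = ∑ u ∈ B.filter (fun u => u ≠ z ∧ 1 ≤ drop z u), (1 : ℝ) := by simp
        _ ≤ ∑ u ∈ B.filter (fun u => u ≠ z ∧ 1 ≤ drop z u), drop z u :=
            Finset.sum_le_sum fun u hu => (Finset.mem_filter.1 hu).2.2
        _ ≤ ∑ u ∈ S z, drop z u := by
            refine Finset.sum_le_sum_of_subset_of_nonneg ?_ fun u hu _ =>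
              hf.score_drop_nonneg hne hu
            intro u hu
            obtain ⟨huB, huz, -⟩ := Finset.mem_filter.1 hu
            exact hBS z hz u huB huz
    simp only [drop] at hsum ⊢
    linarith

open Classical in
/-- Among the first `n + 1` draws, only few can be attacked when they are moved to the end. -/
theorem IsGood.sum_attackable_swap_le (hf : IsGood C 3 1 1 f) {α : ℝ} (hα : 0 ≤ α)
    {target : X → Label} (ht : target ∈ C) (ω : ℕ → X) (n : ℕ) :
    (∑ j ∈ Finset.range (n + 1),
      if Attackable (potentialLearner C 1 f α) target (ω ∘ Equiv.swap j n) n then (1 : ℝ) else 0)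
        ≤ 6 * α + 9 := by
  set J := (Finset.range (n + 1)).filter fun j =>
    Attackable (potentialLearner C 1 f α) target (ω ∘ Equiv.swap j n) n with hJ
  have hatt : ∀ j ∈ J, ∃ S : Finset (Labeled X),
      (∀ i ∈ J, i ≠ j → (ω i, target (ω i)) ∈ S) ∧ Consistent target (S : Set (Labeled X)) ∧
        potentialLearner C 1 f α S (ω j) = none := by
    intro j hj
    obtain ⟨hjn, S, hmem, hcons, hnone⟩ := Finset.mem_filter.1 hj
    refine ⟨S, fun i hi hij => ?_, hcons, by simpa using hnone⟩
    have hin := Finset.mem_range.1 (Finset.mem_filter.1 hi).1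
    have hjn := Finset.mem_range.1 hjn
    have := hmem (Equiv.swap j n i) (by
      rcases eq_or_ne i n with rfl | hne
      · rw [Equiv.swap_apply_right]; omega
      · rw [Equiv.swap_apply_of_ne_of_ne hij hne]; omega)
    simpa using this
  -- A repeated example would already lie in the attacking set, where its label is forced and the
  -- learner cannot abstain.
  have hinj : Set.InjOn (fun j => ((ω j, target (ω j)) : Labeled X)) J := by
    intro i hi j hj hij
    by_contra hne
    obtain ⟨S, hmem, -, hnone⟩ := hatt j hj
    have := hmem i hi hne
    simp only at hij
    rw [hij] at this
    exact not_mem_of_potentialLearner_eq_none (z := (ω j, target (ω j))) hnone this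
  have hcard := hf.card_attackable_le hα ht (J.image fun j => ((ω j, target (ω j)) : Labeled X))
    (by
      intro z hz
      obtain ⟨j, -, rfl⟩ := Finset.mem_image.1 (Finset.mem_coe.1 hz)
      rfl)
    (by
      intro z hz
      obtain ⟨j, hj, rfl⟩ := Finset.mem_image.1 hz
      obtain ⟨S, hmem, hcons, hnone⟩ := hatt j hj
      refine ⟨S, fun w hw hne => ?_, hcons, hnone⟩
      obtain ⟨i, hi, rfl⟩ := Finset.mem_image.1 hw
      exact hmem i hi fun h => hne (by rw [h]))
  rw [Finset.card_image_of_injOn hinj] at hcard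
  rw [Finset.sum_boole]
  exact hcard

end Counting

/-! ### Exchangeability of the draws without measurability -/

section Exchangeability

/-- Superadditivity of the lower integral over finite sums. -/
theorem sum_lintegral_le_lintegral_sum {Ω ι : Type*} [MeasurableSpace Ω] (μ : Measure Ω)
    (s : Finset ι) (g : ι → Ω → ENNReal) :
    ∑ i ∈ s, ∫⁻ x, g i x ∂μ ≤ ∫⁻ x, ∑ i ∈ s, g i x ∂μ := by
  classical
  induction s using Finset.induction_on with
  | empty => simp
  | insert i s hi ih =>
    simp only [Finset.sum_insert hi]
    exact (add_le_add le_rfl ih).trans (le_lintegral_add _ _)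

theorem measurePreserving_infinitePi_comp {X : Type*} [MeasurableSpace X] (D : Measure X)
    [IsProbabilityMeasure D] (σ : Equiv.Perm ℕ) :
    ∃ e : (ℕ → X) ≃ᵐ (ℕ → X), (∀ ω, e ω = ω ∘ σ) ∧
      MeasurePreserving e (Measure.infinitePi fun _ : ℕ => D)
        (Measure.infinitePi fun _ : ℕ => D) := by
  refine ⟨MeasurableEquiv.piCongrLeft (fun _ => X) σ.symm, fun ω => ?_,
    (MeasurableEquiv.piCongrLeft (fun _ => X) σ.symm).measurable,
    Measure.infinitePi_map_piCongrLeft (fun _ : ℕ => D) σ.symm⟩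
  funext i
  have := MeasurableEquiv.piCongrLeft_apply_apply (β := fun _ => X) σ.symm ω (σ i)
  simpa using this

/-- Permuting coordinates is a measurable equivalence, so invariance of the product measure
transfers to lower integrals of arbitrary `g`. -/
theorem lintegral_prod_comp_perm {X : Type*} [MeasurableSpace X] (D : Measure X)
    [IsProbabilityMeasure D] {R : Type*} [MeasurableSpace R] (ν : Measure R)
    [IsProbabilityMeasure ν] (σ : Equiv.Perm ℕ) (g : (ℕ → X) → ENNReal) :
    ∫⁻ s, g (s.2 ∘ σ) ∂(ν.prod (Measure.infinitePi fun _ : ℕ => D)) =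
      ∫⁻ s, g s.2 ∂(ν.prod (Measure.infinitePi fun _ : ℕ => D)) := by
  obtain ⟨e, he, hmp⟩ := measurePreserving_infinitePi_comp D σ
  have hprod := (MeasurePreserving.id ν).prod hmp
  have hemb : MeasurableEmbedding (Prod.map id e : R × (ℕ → X) → R × (ℕ → X)) :=
    ((MeasurableEquiv.refl R).prodCongr e).measurableEmbedding
  have := hprod.lintegral_comp_emb hemb fun s => g s.2
  simpa [he] using this

/-- Permutations of `Fin T`, acting on `ℕ`. -/
noncomputable def permNat (T : ℕ) : Equiv.Perm (Fin T) →* Equiv.Perm ℕ :=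
  Equiv.Perm.extendDomainHom Fin.equivSubtype

theorem permNat_swap {T : ℕ} (a b : Fin T) :
    permNat T (Equiv.swap a b) = Equiv.swap (a : ℕ) (b : ℕ) := by
  ext i
  by_cases hi : i < T
  · have h1 := Equiv.Perm.extendDomain_apply_image (Equiv.swap a b)
      (Fin.equivSubtype (n := T)) ⟨i, hi⟩
    have h2 : permNat T (Equiv.swap a b) i = ((Equiv.swap a b ⟨i, hi⟩ : Fin T) : ℕ) := h1
    rw [h2, Equiv.swap_apply_def, Equiv.swap_apply_def]
    simp only [Fin.ext_iff]
    split_ifs <;> rfl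
  · have h1 := Equiv.Perm.extendDomain_apply_not_subtype (Equiv.swap a b)
      (Fin.equivSubtype (n := T)) (b := i) hi
    have h2 : permNat T (Equiv.swap a b) i = i := h1
    rw [h2, Equiv.swap_apply_of_ne_of_ne]
    · rintro rfl; exact hi a.2
    · rintro rfl; exact hi b.2

/-- Averaging over the permutations of independent draws, for functions which need not be
measurable: if the transposed copies of `a n` sum to at most `c`, then the lower integral of
`∑ n < T, a n` is at most `∑ n < T, c / (n + 1)`. -/
theorem lintegral_sum_le_of_swap {X : Type*} [MeasurableSpace X] (D : Measure X)
    [IsProbabilityMeasure D] {R : Type*} [MeasurableSpace R] (ν : Measure R)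
    [IsProbabilityMeasure ν] (T : ℕ) (a : ℕ → (ℕ → X) → ENNReal) (c : ENNReal)
    (h : ∀ n < T, ∀ ω, ∑ j ∈ Finset.range (n + 1), a n (ω ∘ Equiv.swap j n) ≤ c) :
    ∫⁻ s, ∑ n ∈ Finset.range T, a n s.2 ∂(ν.prod (Measure.infinitePi fun _ : ℕ => D)) ≤
      ∑ n ∈ Finset.range T, c / (n + 1 : ℕ) := by
  set N : ENNReal := ((Fintype.card (Equiv.Perm (Fin T)) : ℕ) : ENNReal) with hN
  have hN0 : N ≠ 0 := by simp [hN, Fintype.card_ne_zero]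
  have hNt : N ≠ ⊤ := ENNReal.natCast_ne_top _
  have hpt : ∀ n < T, ∀ ω, ∑ σ : Equiv.Perm (Fin T), a n (ω ∘ permNat T σ) ≤
      N * (c / (n + 1 : ℕ)) := by
    intro n hn ω
    rw [← mul_div_assoc, ENNReal.le_div_iff_mul_le (Or.inl (by simp))
      (Or.inl (ENNReal.natCast_ne_top _))]
    calc (∑ σ : Equiv.Perm (Fin T), a n (ω ∘ permNat T σ)) * ((n + 1 : ℕ) : ENNReal)
        = ∑ j ∈ Finset.range (n + 1), ∑ σ : Equiv.Perm (Fin T), a n (ω ∘ permNat T σ) := by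
          simp [mul_comm]
      _ = ∑ j ∈ Finset.range (n + 1), ∑ σ : Equiv.Perm (Fin T),
            a n ((ω ∘ permNat T σ) ∘ Equiv.swap j n) := by
          refine Finset.sum_congr rfl fun j hj => ?_
          have hjT : j < T := (Nat.lt_succ_iff.1 (Finset.mem_range.1 hj)).trans_lt hn
          -- Right multiplication by a transposition is a bijection of the group, so a swap can be
          -- inserted into the sum over `σ` for free.
          rw [← Equiv.sum_comp (Equiv.mulRight (Equiv.swap (⟨j, hjT⟩ : Fin T) ⟨n, hn⟩))]
          refine Finset.sum_congr rfl fun σ _ => ?_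
          rw [Equiv.coe_mulRight, map_mul, permNat_swap]
          rfl
      _ = ∑ σ : Equiv.Perm (Fin T), ∑ j ∈ Finset.range (n + 1),
            a n ((ω ∘ permNat T σ) ∘ Equiv.swap j n) := Finset.sum_comm
      _ ≤ ∑ _σ : Equiv.Perm (Fin T), c := Finset.sum_le_sum fun σ _ => h n hn _
      _ = N * c := by simp [hN]
  set μ := ν.prod (Measure.infinitePi fun _ : ℕ => D)
  have hmul : N * ∫⁻ s, ∑ n ∈ Finset.range T, a n s.2 ∂μ ≤
      N * ∑ n ∈ Finset.range T, c / (n + 1 : ℕ) := by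
    calc N * ∫⁻ s, ∑ n ∈ Finset.range T, a n s.2 ∂μ
        = ∑ σ : Equiv.Perm (Fin T),
            ∫⁻ s, ∑ n ∈ Finset.range T, a n (s.2 ∘ permNat T σ) ∂μ := by
          rw [Finset.sum_congr rfl fun σ _ => lintegral_prod_comp_perm D ν (permNat T σ)
            fun ω => ∑ n ∈ Finset.range T, a n ω]
          simp [hN, μ]
      -- Lower integrals are superadditive, which is the direction needed. Splitting over `n` would
      -- need the other one; hence one group of permutations averages all `n < T` at once.
      _ ≤ ∫⁻ s, ∑ σ : Equiv.Perm (Fin T), ∑ n ∈ Finset.range T, a n (s.2 ∘ permNat T σ) ∂μ :=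
          sum_lintegral_le_lintegral_sum _ _ _
      _ ≤ ∫⁻ _s, N * ∑ n ∈ Finset.range T, c / (n + 1 : ℕ) ∂μ := by
          refine lintegral_mono fun s => ?_
          rw [Finset.sum_comm, Finset.mul_sum]
          exact Finset.sum_le_sum fun n hn => hpt n (Finset.mem_range.1 hn) s.2
      _ = N * ∑ n ∈ Finset.range T, c / (n + 1 : ℕ) := by
          rw [lintegral_const, measure_univ, mul_one]
  exact (ENNReal.mul_le_mul_iff_right hN0 hNt).1 hmul

end Exchangeability

/-! ### The error bound for good scores -/

section Main

variable {X : Type u} {C : Set (X → Label)} {f : Finset (Labeled X) → Set (X → Label) → ℝ}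

theorem sum_range_inv_succ_le (T : ℕ) :
    ∑ n ∈ Finset.range T, (1 : ℝ) / (n + 1 : ℕ) ≤ 1 + Real.log T := by
  have := harmonic_le_one_add_log T
  simpa [harmonic, one_div] using this

/-- The threshold of the potential learner for the horizon `T`. -/
noncomputable def sqrtThreshold (T : ℕ) : ℝ := if T = 0 then 1 else Real.sqrt T

theorem sqrtThreshold_pos (T : ℕ) : 0 < sqrtThreshold T := by
  unfold sqrtThreshold
  split_ifs with h
  · exact one_pos
  · exact Real.sqrt_pos.2 (by exact_mod_cast Nat.pos_of_ne_zero h)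

theorem IsGood.achievesCombinedError (hf : IsGood C 3 1 1 f) :
    AchievesCombinedError.{u, v} C 1 f sqrtThreshold
      (fun T => 16 * Real.sqrt T * (1 + Real.log T) ^ 1) := by
  classical
  intro T hT _ D _ target ht R _ ν _ adversary
  have hT1 : (1 : ℝ) ≤ T := by exact_mod_cast hT
  have hα : sqrtThreshold T = Real.sqrt T := by
    unfold sqrtThreshold
    rw [if_neg (by omega)]
  rw [hα]
  set α := Real.sqrt T with hαdef
  have hα1 : 1 ≤ α := Real.one_le_sqrt.2 hT1
  have hαsq : α * α = T := Real.mul_self_sqrt (by linarith)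
  set L := potentialLearner C 1 f α
  let a : ℕ → (ℕ → X) → ENNReal := fun n ω => if Attackable L target ω n then 1 else 0
  have hmis : ∀ adv ω, (misErrors (play L target adv ω T) : ℝ) ≤ α := by
    intro adv ω
    have h1 := hf.mul_misErrors_add_potential_le (α := α) ht adv ω T
    have h2 := hf.potential_nonneg (seenExamples (play L target adv ω T))
    have h3 : α * misErrors (play L target adv ω T) ≤ α * α := by
      rw [hαsq]
      linarith
    exact le_of_mul_le_mul_left h3 (by linarith)
  have hpt : ∀ s : R × (ℕ → X),
      ((misErrors (play L target (adversary s.1) s.2 T)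
        + absErrors (play L target (adversary s.1) s.2 T) : ℕ) : ENNReal) ≤
      ENNReal.ofReal α + ∑ n ∈ Finset.range T, a n s.2 := by
    intro s
    rw [Nat.cast_add]
    refine add_le_add ?_ ?_
    · rw [← ENNReal.ofReal_natCast]
      exact ENNReal.ofReal_le_ofReal (hmis _ _)
    · have h1 := (absErrors_play_le L target (adversary s.1) s.2 T).trans
        (Finset.sum_le_sum_of_subset (Finset.range_subset_range.2
          (naturalRounds_play_le L target (adversary s.1) s.2 T)))
      refine (Nat.cast_le.2 h1).trans (le_of_eq ?_)
      simp [a]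
  have hswap : ∀ n < T, ∀ ω : ℕ → X, ∑ j ∈ Finset.range (n + 1), a n (ω ∘ Equiv.swap j n) ≤
      ENNReal.ofReal (6 * α + 9) := by
    intro n _ ω
    have h1 := ENNReal.ofReal_le_ofReal
      (hf.sum_attackable_swap_le (α := α) (by linarith) ht ω n)
    rw [ENNReal.ofReal_sum_of_nonneg (fun j _ => by split_ifs <;> norm_num)] at h1
    refine le_trans (le_of_eq ?_) h1
    refine Finset.sum_congr rfl fun j _ => ?_
    simp only [a, L]
    split_ifs <;> simp
  have hint := lintegral_sum_le_of_swap D ν T a (ENNReal.ofReal (6 * α + 9)) hswap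
  have hlog : 0 ≤ Real.log T := Real.log_nonneg hT1
  have hsum : ∑ n ∈ Finset.range T, ENNReal.ofReal (6 * α + 9) / (n + 1 : ℕ) ≤
      ENNReal.ofReal ((6 * α + 9) * (1 + Real.log T)) := by
    have h1 : ∀ n ∈ Finset.range T, ENNReal.ofReal (6 * α + 9) / (n + 1 : ℕ) =
        ENNReal.ofReal ((6 * α + 9) * (1 / (n + 1 : ℕ))) := by
      intro n _
      rw [mul_one_div, ENNReal.ofReal_div_of_pos (by positivity), ENNReal.ofReal_natCast]
    rw [Finset.sum_congr rfl h1, ← ENNReal.ofReal_sum_of_nonneg (fun n _ => by positivity),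
      ← Finset.mul_sum]
    exact ENNReal.ofReal_le_ofReal
      (mul_le_mul_of_nonneg_left (sum_range_inv_succ_le T) (by linarith))
  unfold expectedCombinedError
  calc _ ≤ ∫⁻ s, (ENNReal.ofReal α + ∑ n ∈ Finset.range T, a n s.2)
          ∂(ν.prod (Measure.infinitePi fun _ : ℕ => D)) := lintegral_mono hpt
    _ = ENNReal.ofReal α + ∫⁻ s, ∑ n ∈ Finset.range T, a n s.2
          ∂(ν.prod (Measure.infinitePi fun _ : ℕ => D)) := by
        -- Additivity needs only one measurable summand, here the constant.
        rw [lintegral_add_left measurable_const, lintegral_const, measure_univ, mul_one]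
    _ ≤ ENNReal.ofReal α + ENNReal.ofReal ((6 * α + 9) * (1 + Real.log T)) :=
        add_le_add le_rfl (hint.trans hsum)
    _ = ENNReal.ofReal (α + (6 * α + 9) * (1 + Real.log T)) :=
        (ENNReal.ofReal_add (by linarith) (by positivity)).symm
    _ ≤ _ := by
        refine ENNReal.ofReal_le_ofReal ?_
        change _ ≤ 16 * α * (1 + Real.log T) ^ 1
        rw [pow_one]
        -- Since `α ≥ 1`, the constants add up to `16 = 1 + 6 + 9`.
        nlinarith [mul_nonneg (by linarith : 0 ≤ α - 1) hlog, mul_nonneg (by linarith : 0 ≤ α) hlog]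

end Main

/-! ### Goodness of the segment score -/

section Segments

variable {X : Type u}

open Classical in
/-- The score for classes of initial segments where, at the point `x`, the label `s x` plays the
role of `+1`: the indicator that all points with forced label `s x` lie below the given ones. -/
noncomputable def signedSegScore [PartialOrder X] (s : X → Label)
    (U : Finset (Labeled X)) (V : Set (X → Label)) : ℝ :=
  if ∀ z ∈ U, {x | restrict V x (-s x) = ∅} ⊆ Set.Iic z.1 then 1 else 0

theorem segScore_eq_signedSegScore [PartialOrder X] :
    segScore (X := X) = signedSegScore fun _ => 1 := rfl

theorem restrict_restrict_subset (V : Set (X → Label)) (x a : X) (y b : Label)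
    (h : restrict V a b = ∅) : restrict (restrict V x y) a b = ∅ := by
  rw [Set.eq_empty_iff_forall_notMem] at h ⊢
  exact fun g hg => h g ⟨hg.1.1, hg.2⟩

/-- Two examples on which the target agrees or disagrees with `s` simultaneously already witness robustness. -/
theorem signedSegScore_robust_pair [PartialOrder X] {C : Set (X → Label)} {s : X → Label}
    (hC : ∀ h ∈ C, IsInitialSegment {x | h x = s x}) {h : X → Label} (hh : h ∈ C) {a b : X}
    (hab : a ≠ b) (hsign : h a = s a ↔ h b = s b) :
    ∃ u z : X, ((u = a ∧ z = b) ∨ (u = b ∧ z = a)) ∧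
      ∀ A : Set (Labeled X), Consistent h A →
        1 ≤ signedSegScore s {(u, h u)} (versionSpace C A) -
            signedSegScore s {(u, h u)} (restrict (versionSpace C A) z (-h z)) ∨
          ¬ RealizableIn ((({(u, h u)} : Finset (Labeled X))) : Set (Labeled X))
            (restrict (versionSpace C A) z (-h z)) := by
  have hlow := (hC h hh).1
  have hchain := (hC h hh).2
  by_cases ha : h a = s a
  · have hb := hsign.1 ha
    -- Segments are downward closed, so keeping the upper point `u` inside keeps `z` inside as well.
    have key : ∀ u z : X, h u = s u → h z = s z → z ≤ u → ∀ A : Set (Labeled X),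
        ¬ RealizableIn ((({(u, h u)} : Finset (Labeled X))) : Set (Labeled X))
            (restrict (versionSpace C A) z (-h z)) := by
      rintro u z hu hz hzu A ⟨g, ⟨⟨hgC, -⟩, hgz⟩, hgU⟩
      have hgu : g u = h u := hgU (u, h u) (by simp)
      have : g z = s z := (hC g hgC).1 hzu (hgu.trans hu)
      rw [this, hz] at hgz
      exact Label.ne_neg_self _ hgz
    rcases hchain ha hb hab with hle | hle
    · exact ⟨b, a, Or.inr ⟨rfl, rfl⟩, fun A _ => Or.inr (key b a hb ha hle A)⟩
    · exact ⟨a, b, Or.inl ⟨rfl, rfl⟩, fun A _ => Or.inr (key a b ha hb hle A)⟩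
  · have hb : ¬ h b = s b := fun hb => ha (hsign.2 hb)
    -- an example above the other one
    have key1 : ∀ u z : X, h u ≠ s u → h z ≠ s z → u ≤ z → ∀ A : Set (Labeled X),
        ¬ RealizableIn ((({(u, h u)} : Finset (Labeled X))) : Set (Labeled X))
            (restrict (versionSpace C A) z (-h z)) := by
      rintro u z hu hz huz A ⟨g, ⟨⟨hgC, -⟩, hgz⟩, hgU⟩
      have hgu : g u = h u := hgU (u, h u) (by simp)
      have hgz' : g z = s z := by
        rw [hgz, Label.eq_neg_of_ne hz, neg_neg]
      exact hu (hgu.symm.trans ((hC g hgC).1 huz hgz'))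
    -- incomparable examples
    have key2 : ∀ u z : X, h u ≠ s u → h z ≠ s z → ¬ z ≤ u →
        {x | x ≤ z ∧ h x = s x} ⊆ Set.Iic u → ∀ A : Set (Labeled X), Consistent h A →
        1 ≤ signedSegScore s {(u, h u)} (versionSpace C A) -
            signedSegScore s {(u, h u)} (restrict (versionSpace C A) z (-h z)) ∨
          ¬ RealizableIn ((({(u, h u)} : Finset (Labeled X))) : Set (Labeled X))
            (restrict (versionSpace C A) z (-h z)) := by
      intro u z hu hz hzu hsub A hA
      refine or_iff_not_imp_right.2 fun hreal => ?_
      obtain ⟨g, ⟨hgV, hgz⟩, -⟩ := not_not.1 hreal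
      have hzs : -h z = s z := by rw [Label.eq_neg_of_ne hz, neg_neg]
      have hforced : ∀ k ∈ versionSpace C A, ∀ x,
          restrict (versionSpace C A) x (-s x) = ∅ → k x = s x := by
        intro k hk x hx
        by_contra hne
        exact Set.eq_empty_iff_forall_notMem.1 hx k ⟨hk, Label.eq_neg_of_ne hne⟩
      -- Forced points lie in the segments of both `h` and `g`. The segment of `g` contains `z`, so
      -- they are comparable with `z`; none is above `z`, which is outside the segment of `h`.
      have h1 : signedSegScore s {(u, h u)} (versionSpace C A) = 1 := by
        unfold signedSegScore
        rw [if_pos]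
        intro w hw x hx
        rw [Finset.mem_singleton.1 hw]
        have hxh := hforced h ⟨hh, hA⟩ x hx
        have hxg := hforced g hgV x hx
        refine hsub ⟨?_, hxh⟩
        by_contra hxz
        have hzx : z ≤ x :=
          ((hC g hgV.1).2.total hxg (hgz.trans hzs)).resolve_left hxz
        exact hz (hlow hzx hxh)
      -- After the restriction `z` itself is forced, and it is not below `u`.
      have h2 : signedSegScore s {(u, h u)} (restrict (versionSpace C A) z (-h z)) = 0 := by
        unfold signedSegScore
        rw [if_neg]
        intro hall
        refine hzu (hall (u, h u) (Finset.mem_singleton_self _) ?_)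
        refine Set.eq_empty_iff_forall_notMem.2 ?_
        rintro k ⟨⟨-, hkz⟩, hkz'⟩
        rw [hkz, hzs] at hkz'
        exact Label.ne_neg_self _ hkz'
      rw [h1, h2]
      norm_num
    by_cases hle : a ≤ b
    · exact ⟨a, b, Or.inl ⟨rfl, rfl⟩, fun A _ => Or.inr (key1 a b ha hb hle A)⟩
    by_cases hge : b ≤ a
    · exact ⟨b, a, Or.inr ⟨rfl, rfl⟩, fun A _ => Or.inr (key1 b a hb ha hge A)⟩
    -- The parts of the segment of `h` below `a` and below `b` are nested because the segment is a
    -- chain; this decides which example plays `u`.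
    by_cases hsub : {x | x ≤ a ∧ h x = s x} ⊆ Set.Iic b
    · exact ⟨b, a, Or.inr ⟨rfl, rfl⟩, key2 b a hb ha hle hsub⟩
    · refine ⟨a, b, Or.inl ⟨rfl, rfl⟩, key2 a b ha hb hge ?_⟩
      obtain ⟨x, ⟨hxa, hxs⟩, hxb⟩ := Set.not_subset.1 hsub
      rintro y ⟨hyb, hys⟩
      rcases hchain.total hxs hys with hxy | hyx
      · exact absurd (hxy.trans hyb) hxb
      · exact hyx.trans hxa

/-- Among three points, two have the same truth value. -/
theorem exists_pair_iff_of_card_eq_three {β : Type*} (M : Finset β) (hM : M.card = 3)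
    (P : β → Prop) : ∃ a ∈ M, ∃ b ∈ M, a ≠ b ∧ (P a ↔ P b) := by
  classical
  obtain ⟨a, b, c, hab, hac, hbc, rfl⟩ := Finset.card_eq_three.1 hM
  by_cases h1 : P a ↔ P b
  · exact ⟨a, by simp, b, by simp, hab, h1⟩
  by_cases h2 : P a ↔ P c
  · exact ⟨a, by simp, c, by simp, hac, h2⟩
  · exact ⟨b, by simp, c, by simp, hbc, by tauto⟩

theorem isGood_signedSegScore [PartialOrder X] {C : Set (X → Label)} {s : X → Label}
    (hC : ∀ h ∈ C, IsInitialSegment {x | h x = s x}) : IsGood C 3 1 1 (signedSegScore s) where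
  bounded U _ V _ := by
    unfold signedSegScore
    split_ifs <;> simp
  monotone U _ V _ x y _ := by
    unfold signedSegScore
    split_ifs with h1 h2
    · exact le_rfl
    -- Restriction only enlarges the forced set, so the indicator can only fall.
    · exact absurd (fun z hz a ha => h1 z hz (restrict_restrict_subset V x a y _ ha)) h2
    · exact zero_le_one
    · exact le_rfl
  robust h hh M hM3 hM := by
    obtain ⟨a, ha, b, hb, hab, hsign⟩ :=
      exists_pair_iff_of_card_eq_three M hM3 fun z => h z.1 = s z.1
    have hea : a = (a.1, h a.1) := Prod.ext rfl (hM a ha).symm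
    have heb : b = (b.1, h b.1) := Prod.ext rfl (hM b hb).symm
    have hne : a.1 ≠ b.1 := fun h' => hab (by rw [hea, heb, h'])
    have wrap : ∀ u ∈ M, ∀ z ∈ M, u ≠ z → (∀ A : Set (Labeled X), Consistent h A →
        1 ≤ signedSegScore s {(u.1, h u.1)} (versionSpace C A) -
            signedSegScore s {(u.1, h u.1)} (restrict (versionSpace C A) z.1 (-h z.1)) ∨
          ¬ RealizableIn ((({(u.1, h u.1)} : Finset (Labeled X))) : Set (Labeled X))
            (restrict (versionSpace C A) z.1 (-h z.1))) → _ := fun u hu z hz huz hA => by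
      have heu : (u.1, h u.1) = u := Prod.ext rfl (hM u hu)
      have hez : h z.1 = z.2 := hM z hz
      rw [heu, hez] at hA
      exact (⟨{u}, Finset.singleton_subset_iff.2 hu, Finset.card_singleton u, z, hz,
        fun h' => huz (Finset.mem_singleton.1 h').symm, fun A _ hc => hA A hc⟩ :
        ∃ U : Finset (Labeled X), U ⊆ M ∧ U.card = 1 ∧ ∃ z ∈ M, z ∉ U ∧
          ∀ A : Set (Labeled X), (∀ a ∈ M, a ∉ U → a ≠ z → a ∈ A) → Consistent h A →
            1 ≤ signedSegScore s U (versionSpace C A) -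
                signedSegScore s U (restrict (versionSpace C A) z.1 (-z.2)) ∨
              ¬ RealizableIn (U : Set (Labeled X)) (restrict (versionSpace C A) z.1 (-z.2)))
    obtain ⟨u, z, (⟨rfl, rfl⟩ | ⟨rfl, rfl⟩), hA⟩ := signedSegScore_robust_pair hC hh hne hsign
    · exact wrap a ha b hb hab hA
    · exact wrap b hb a ha hab.symm hA

end Segments

/-! ### Tree orders and VC dimension at most one -/

section Structure

variable {X : Type u}

/-- The order of a family `F` of sets: `x` is below `y` if `y` belongs to some member of `F`, all
members that contain `y` contain `x`, and ties are broken by a linear order. -/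
def FamilyLE [LinearOrder X] (F : Set (Set X)) (x y : X) : Prop :=
  x = y ∨ ((∃ A ∈ F, y ∈ A) ∧ (∀ A ∈ F, y ∈ A → x ∈ A) ∧ ((∀ A ∈ F, x ∈ A → y ∈ A) → x < y))

/-- `FamilyLE F` as a partial order. -/
abbrev familyOrder [LinearOrder X] (F : Set (Set X)) : PartialOrder X where
  le := FamilyLE F
  lt x y := FamilyLE F x y ∧ ¬ FamilyLE F y x
  lt_iff_le_not_ge _ _ := Iff.rfl
  le_refl x := Or.inl rfl
  le_trans x y z hxy hyz := by
    rcases hxy with rfl | ⟨hy, hxy, hxy'⟩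
    · exact hyz
    rcases hyz with rfl | ⟨hz, hyz, hyz'⟩
    · exact Or.inr ⟨hy, hxy, hxy'⟩
    · refine Or.inr ⟨hz, fun A hA h => hxy A hA (hyz A hA h), fun h => ?_⟩
      -- If `x` and `z` lie in the same members, so does `y` between them, and both tie-breaks
      -- apply.
      exact (hxy' fun A hA hx => hyz A hA (h A hA hx)).trans
        (hyz' fun A hA hy => h A hA (hxy A hA hy))
  le_antisymm x y hxy hyx := by
    rcases hxy with rfl | ⟨-, hxy, hxy'⟩
    · rfl
    rcases hyx with rfl | ⟨-, hyx, hyx'⟩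
    · rfl
    · exact absurd ((hxy' hyx).trans (hyx' hxy)) (lt_irrefl _)

theorem familyLE_total [LinearOrder X] {F : Set (Set X)}
    (hF : ∀ A ∈ F, ∀ x ∈ A, ∀ y ∈ A, (∀ B ∈ F, x ∈ B → y ∈ B) ∨ (∀ B ∈ F, y ∈ B → x ∈ B))
    {A : Set X} (hA : A ∈ F) {x y : X} (hx : x ∈ A) (hy : y ∈ A) :
    FamilyLE F x y ∨ FamilyLE F y x := by
  by_cases h1 : ∀ B ∈ F, x ∈ B → y ∈ B
  · by_cases h2 : ∀ B ∈ F, y ∈ B → x ∈ B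
    · rcases lt_trichotomy x y with h | h | h
      · exact Or.inl (Or.inr ⟨⟨A, hA, hy⟩, h2, fun _ => h⟩)
      · exact Or.inl (Or.inl h)
      · exact Or.inr (Or.inr ⟨⟨A, hA, hx⟩, h1, fun _ => h⟩)
    · exact Or.inr (Or.inr ⟨⟨A, hA, hx⟩, h1, fun h => absurd h h2⟩)
  · exact Or.inl (Or.inr ⟨⟨A, hA, hy⟩, (hF A hA x hx y hy).resolve_left h1,
      fun h => absurd h h1⟩)

theorem familyLE_mem [LinearOrder X] {F : Set (Set X)} {A : Set X} (hA : A ∈ F) {x y : X}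
    (hxy : FamilyLE F x y) (hy : y ∈ A) : x ∈ A := by
  rcases hxy with rfl | ⟨-, h, -⟩
  · exact hy
  · exact h A hA hy

/-- A family of sets in which no two members of a common set are separated in both directions
consists of initial segments of a tree order. -/
theorem exists_treeOrder_of_family (F : Set (Set X))
    (hF : ∀ A ∈ F, ∀ x ∈ A, ∀ y ∈ A, (∀ B ∈ F, x ∈ B → y ∈ B) ∨ (∀ B ∈ F, y ∈ B → x ∈ B)) :
    ∃ _ : PartialOrder X, IsTreeOrder X ∧ ∀ A ∈ F, IsInitialSegment A := by
  classical
  let _ : LinearOrder X := linearOrderOfSTO WellOrderingRel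
  refine ⟨familyOrder F, ?_, ?_⟩
  · intro z x hx y hy _
    rcases hx with rfl | ⟨⟨A, hA, hz⟩, hx, hx'⟩
    -- A point in no member has only itself below it; otherwise everything below `z` lies in a
    -- common member `A`.
    · exact Or.inr hy
    rcases hy with rfl | ⟨-, hy, -⟩
    · exact Or.inl (Or.inr ⟨⟨A, hA, hz⟩, hx, hx'⟩)
    · exact familyLE_total hF hA (hx A hA hz) (hy A hA hz)
  · exact fun A hA => ⟨fun y x hxy hy => familyLE_mem hA hxy hy,
      fun x hx y hy _ => familyLE_total hF hA hx hy⟩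

theorem relabel_eq_one_iff (r h : X → Label) (x : X) : relabel r h x = 1 ↔ h x = -r x := by
  unfold relabel
  rcases Int.units_eq_one_or (h x) with h1 | h1 <;> rcases Int.units_eq_one_or (r x) with h2 | h2 <;>
    rw [h1, h2] <;> decide

open Classical in
theorem classShatters_pair {C : Set (X → Label)} {r : X → Label} {x y : X}
    (h00 : ∃ h ∈ C, h x = r x ∧ h y = r y) (h01 : ∃ h ∈ C, h x = r x ∧ h y = -r y)
    (h10 : ∃ h ∈ C, h x = -r x ∧ h y = r y) (h11 : ∃ h ∈ C, h x = -r x ∧ h y = -r y) :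
    ClassShatters C {x, y} := by
  intro l
  have hsel : ∃ h ∈ C, h x = l x ∧ h y = l y := by
    rcases eq_or_ne (l x) (r x) with hx | hx <;> rcases eq_or_ne (l y) (r y) with hy | hy
    · rw [hx, hy]; exact h00
    · rw [hx, Label.eq_neg_of_ne hy]; exact h01
    · rw [Label.eq_neg_of_ne hx, hy]; exact h10
    · rw [Label.eq_neg_of_ne hx, Label.eq_neg_of_ne hy]; exact h11
  obtain ⟨h, hC, hx, hy⟩ := hsel
  refine ⟨h, hC, fun w hw => ?_⟩
  rcases Finset.mem_insert.1 hw with rfl | hw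
  · exact hx
  · rw [Finset.mem_singleton.1 hw]; exact hy

/-- If `x` and `y` are separated both ways by disagreement sets and also lie in a common one, these
three concepts and `r` itself realize all four patterns on `{x, y}`. -/
theorem VCDimLE.exists_treeOrder {C : Set (X → Label)} (hC : VCDimLE C 1) {r : X → Label}
    (hr : r ∈ C) : ∃ _ : PartialOrder X, IsTreeOrder X ∧
      ∀ h ∈ C, IsInitialSegment {x | relabel r h x = 1} := by
  classical
  obtain ⟨P, htree, hseg⟩ := exists_treeOrder_of_family
    ((fun h : X → Label => {x | relabel r h x = 1}) '' C) (by
      rintro _ ⟨h, hh, rfl⟩ x hx y hy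
      by_contra! hcon
      obtain ⟨⟨_, ⟨h1, hh1, rfl⟩, h1x, h1y⟩, ⟨_, ⟨h2, hh2, rfl⟩, h2y, h2x⟩⟩ := hcon
      simp only [Set.mem_ofPred_eq, relabel_eq_one_iff] at hx hy h1x h1y h2x h2y
      have hne : x ≠ y := by rintro rfl; exact h1y h1x
      have hs : ClassShatters C {x, y} := classShatters_pair (r := r) ⟨r, hr, rfl, rfl⟩
        ⟨h2, hh2, (Label.eq_neg_of_ne h2x).trans (neg_neg _), h2y⟩
        ⟨h1, hh1, h1x, (Label.eq_neg_of_ne h1y).trans (neg_neg _)⟩ ⟨h, hh, hx, hy⟩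
      have := hC _ hs
      rw [Finset.card_pair hne] at this
      omega)
  exact ⟨P, htree, fun h hh => hseg _ ⟨h, hh, rfl⟩⟩

/-- On a shattered pair, the concept opposite to `r` at both points makes them comparable; the
concept opposite to `r` only at the upper one is then not downward closed. -/
theorem vcDimLE_one_of_forall_segment {C : Set (X → Label)}
    (hC : ∀ r ∈ C, ∃ _ : PartialOrder X, IsTreeOrder X ∧
      ∀ h ∈ C, IsInitialSegment {x | relabel r h x = 1}) : VCDimLE C 1 := by
  classical
  intro S hS
  by_contra! hcard
  obtain ⟨x, hx, y, hy, hxy⟩ := Finset.one_lt_card.1 hcard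
  obtain ⟨r, hr, -⟩ := hS fun _ => 1
  obtain ⟨P, -, hseg⟩ := hC r hr
  obtain ⟨g, hg, hgl⟩ := hS fun w => -r w
  have hpos : ∀ w ∈ S, w ∈ {x | relabel r g x = 1} := fun w hw =>
    (relabel_eq_one_iff r g w).2 (hgl w hw)
  have key : ∀ a ∈ S, ∀ b ∈ S, a ≠ b → ¬ a ≤ b := by
    intro a ha b hb hab hle
    obtain ⟨k, hk, hkl⟩ := hS fun w => if w = a then r w else -r w
    have h1 : relabel r k b = 1 :=
      (relabel_eq_one_iff r k b).2 ((hkl b hb).trans (if_neg hab.symm))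
    have h2 : relabel r k a = 1 := (hseg k hk).1 hle h1
    have h3 := (relabel_eq_one_iff r k a).1 h2
    rw [hkl a ha, if_pos rfl] at h3
    exact Label.ne_neg_self _ h3
  rcases (hseg g hg).2 (hpos x hx) (hpos y hy) hxy with hle | hle
  · exact key x hx y hy hxy hle
  · exact key y hy x hx hxy.symm hle

end Structure

theorem corollary4p9 :
    ∃ (K : ℝ) (p : ℕ) (α : ℕ → ℝ), (∀ T, 0 < α T) ∧
      -- classes of initial segments of a tree order
      (∀ (X : Type u) (_ : PartialOrder X), IsTreeOrder X →
        ∀ C : Set (X → Label), (∀ h ∈ C, IsInitialSegment {x | h x = 1}) →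
          IsGood C 3 1 1 segScore ∧
          AchievesCombinedError.{u, v} C 1 segScore α
            (fun T => K * Real.sqrt T * (1 + Real.log T) ^ p)) ∧
      -- the structure of classes of VC dimension at most one
      (∀ (X : Type u) (C : Set (X → Label)),
        VCDimLE C 1 ↔ ∀ r ∈ C, ∃ _ : PartialOrder X, IsTreeOrder X ∧
          ∀ h ∈ C, IsInitialSegment {x | relabel r h x = 1}) ∧
      -- arbitrary classes of VC dimension at most one
      (∀ (X : Type u) (C : Set (X → Label)), VCDimLE C 1 →
        ∃ f : Finset (Labeled X) → Set (X → Label) → ℝ,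
          IsGood C 3 1 1 f ∧
          AchievesCombinedError.{u, v} C 1 f α
            (fun T => K * Real.sqrt T * (1 + Real.log T) ^ p)) := by
  refine ⟨16, 1, sqrtThreshold, sqrtThreshold_pos, ?_, ?_, ?_⟩
  · intro X _ _ C hC
    have hgood : IsGood C 3 1 1 segScore :=
      segScore_eq_signedSegScore (X := X) ▸ isGood_signedSegScore hC
    exact ⟨hgood, hgood.achievesCombinedError⟩
  · exact fun X C => ⟨fun hC r hr => hC.exists_treeOrder hr, vcDimLE_one_of_forall_segment⟩
  · intro X C hC
    have hex : ∃ f : Finset (Labeled X) → Set (X → Label) → ℝ, IsGood C 3 1 1 f := by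
      rcases C.eq_empty_or_nonempty with rfl | ⟨r, hr⟩
      · exact ⟨fun _ _ => 0, fun _ _ _ _ => by simp, fun _ _ _ _ _ _ _ => le_rfl,
          fun h hh => absurd hh (Set.notMem_empty h)⟩
      · obtain ⟨P, -, hseg⟩ := hC.exists_treeOrder hr
        -- The label `-r x` marks disagreement with `r`, which is `+1` after relabeling.
        refine ⟨signedSegScore fun x => -r x, isGood_signedSegScore fun h hh => ?_⟩
        simpa only [relabel_eq_one_iff] using hseg h hh
    obtain ⟨f, hf⟩ := hex
    exact ⟨f, hf, hf.achievesCombinedError⟩
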